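/- Consider the control system $\dot y(t)=f(y(t))+B(y(t))u(t)$ in $\mathbb{R}^d$, with controls in $\mathbb{R}^m$, and let $Q\in\mathbb{R}^{d\times d}$ be symmetric positive semidefinite and $R\in\mathbb{R}^{m\times m}$ symmetric positive definite. Call a real square matrix stable if all its eigenvalues lie in the open left half of the complex plane; $(A,B)$ is stabilizable if $A-BK$ is stable for some $K\in\mathbb{R}^{m\times d}$, and $(A,C)$ is detectable if $(A^\top,C^\top)$ is stabilizable. Assume that, for some $\hat r>0$, $f$ is continuously differentiable on $\{\|x\|\le\hat r\}$, and that there is a neighborhood $\mathcal{O}\subseteq B_{\hat r}(0)$ of the origin such that $f(x)=A(x)x$ on $\mathcal{O}$, the matrix functions $A:\mathcal{O}\to\mathbb{R}^{d\times d}$ and $B:\mathcal{O}\to\mathbb{R}^{d\times m}$ are continuous, and for every $x\in\mathcal{O}$ the pair $(A(x),B(x))$ is stabilizable and the pair $(A(x),Q^{1/2})$ is detectable. For $x\in\mathcal{O}$ let $P(x)$ be the symmetric positive semidefinite solution of the state-dependent Riccati equation $$A(x)^\top P(x)+P(x)A(x)-P(x)B(x)R^{-1}B(x)^\top P(x)+Q=0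 ,$$ and assume that $P$ is continuously differentiable in a neighborhood of the origin. Put $V_S(x)=x^\top P(x)x$ and $$\tilde u_S(x)=-\tfrac12 R^{-1}B(x)^\top\nabla V_S(x).$$ Then the origin is locally asymptotically stable for the closed-loop system $\dot y=f(y)+B(y)\tilde u_S(y)$. That is: the origin is an equilibrium; for every $\varepsilon>0$ there is $\delta>0$ such that for every $x$ with $\|x\|<\delta$ there is a solution on $[0,\infty)$ with $y(0)=x$, and every solution with $y(0)=x$, on whatever interval $[0,T)$ it is defined, satisfies $\|y(t)\|<\varepsilon$ there; and there is $\eta>0$ such that every solution on $[0,\infty)$ with $\|y(0)\|<\eta$ satisfies $y(t)\to0$ as $t\to\infty$. -/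

import Mathlib

open scoped Matrix MatrixOrder Topology

noncomputable section

namespace SDRE

/-- A real square matrix is Hurwitz (stable) if all its complex eigenvalues lie in the open left
half plane. -/
def IsHurwitz {d : ℕ} (M : Matrix (Fin d) (Fin d) ℝ) : Prop :=
  ∀ z ∈ spectrum ℂ (M.map Complex.ofReal), z.re < 0

/-- `(A, B)` is stabilizable if `A - B K` is stable for some feedback matrix `K`. -/
def Stabilizable {d m : ℕ} (A : Matrix (Fin d) (Fin d) ℝ) (B : Matrix (Fin d) (Fin m) ℝ) : Prop :=
  ∃ K : Matrix (Fin m) (Fin d) ℝ, IsHurwitz (A - B * K)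

/-- `(A, C)` is detectable if `(Aᵀ, Cᵀ)` is stabilizable. -/
def Detectable {d p : ℕ} (A : Matrix (Fin d) (Fin d) ℝ) (C : Matrix (Fin p) (Fin d) ℝ) : Prop :=
  Stabilizable Aᵀ Cᵀ

/-- `P` is a symmetric positive semidefinite solution of the algebraic Riccati equation with
coefficients `A, B, Q, R`. -/
def IsRiccatiSolution {d m : ℕ} (A : Matrix (Fin d) (Fin d) ℝ) (B : Matrix (Fin d) (Fin m) ℝ)
    (Q : Matrix (Fin d) (Fin d) ℝ) (R : Matrix (Fin m) (Fin m) ℝ)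
    (P : Matrix (Fin d) (Fin d) ℝ) : Prop :=
  P.PosSemidef ∧ Aᵀ * P + P * A - P * B * R⁻¹ * Bᵀ * P + Q = 0

/-- `V_S(x) = xᵀ P(x) x`. -/
def valueS {d : ℕ} (P : EuclideanSpace ℝ (Fin d) → Matrix (Fin d) (Fin d) ℝ)
    (x : EuclideanSpace ℝ (Fin d)) : ℝ :=
  x.ofLp ⬝ᵥ (P x *ᵥ x.ofLp)

/-- The corrected feedback `-(1/2) R⁻¹ B(x)ᵀ ∇V_S(x)`. -/
def correctedFeedback {d m : ℕ} (B : EuclideanSpace ℝ (Fin d) → Matrix (Fin d) (Fin m) ℝ)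
    (R : Matrix (Fin m) (Fin m) ℝ) (P : EuclideanSpace ℝ (Fin d) → Matrix (Fin d) (Fin d) ℝ)
    (x : EuclideanSpace ℝ (Fin d)) : EuclideanSpace ℝ (Fin m) :=
  WithLp.toLp 2 (-((1 / 2 : ℝ) • (R⁻¹ *ᵥ ((B x)ᵀ *ᵥ (gradient (valueS P) x).ofLp))))

/-- The right-hand side `f(x) + B(x) u(x)` of the system under a state feedback `u`. -/
def closedLoop {d m : ℕ} (f : EuclideanSpace ℝ (Fin d) → EuclideanSpace ℝ (Fin d))
    (B : EuclideanSpace ℝ (Fin d) → Matrix (Fin d) (Fin m) ℝ)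
    (u : EuclideanSpace ℝ (Fin d) → EuclideanSpace ℝ (Fin m))
    (x : EuclideanSpace ℝ (Fin d)) : EuclideanSpace ℝ (Fin d) :=
  f x + WithLp.toLp 2 (B x *ᵥ (u x).ofLp)

/-- Local asymptotic stability of the origin for `y' = F(y)`: the origin is an equilibrium; it is
Lyapunov stable, i.e. solutions starting close to it exist for all future times and every solution
starting close to it, on whatever interval `[0, T)` it is defined, remains close to it; and it is
locally attractive. Uniqueness of solutions is not presupposed: the last two requirements concern
every solution. At the end point `0` the derivative is one-sided. -/
def LocallyAsymptoticallyStable {E : Type*} [NormedAddCommGroup E] [NormedSpace ℝ E]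
    (F : E → E) : Prop :=
  F 0 = 0 ∧
  (∀ ε > 0, ∃ δ > 0, ∀ x : E, ‖x‖ < δ →
    (∃ y : ℝ → E, y 0 = x ∧ IsIntegralCurveOn y (fun _ => F) (Set.Ici 0)) ∧
    ∀ (T : ℝ) (y : ℝ → E), y 0 = x → IsIntegralCurveOn y (fun _ => F) (Set.Ico 0 T) →
      ∀ t ∈ Set.Ico 0 T, ‖y t‖ < ε) ∧
  ∃ η > 0, ∀ y : ℝ → E, ‖y 0‖ < η → IsIntegralCurveOn y (fun _ => F) (Set.Ici 0) →
    Filter.Tendsto y Filter.atTop (𝓝 0)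

end SDRE

end

open scoped Matrix MatrixOrder Topology

/-! The closed loop is linearized at the origin. Since `P` is continuously differentiable there,
`∇V_S(x) = 2 P(x) x + O(‖x‖²)`: the correction to the usual Riccati feedback is of second order. As
`A` and `B` are continuous, the closed loop is therefore `M x + o(‖x‖)` with `M = A - B R⁻¹ Bᵀ P`
taken at `0`.

The matrix `M` is stable (`SDRE.IsRiccatiSolution.isHurwitz`): on an eigenvector with eigenvalue in
the closed right half plane, the Riccati equation forces both the output and the feedback to vanish,
so the eigenvector is shared with the stable matrix `A - Kᵀ C` given by detectability.

A quadratic Lyapunov function for `M` (`SDRE.IsHurwitz.exists_lyapunov`) still decays along the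
nonlinear field near `0`, which confines every solution and makes it decay exponentially. The field
is known only to be continuous near `0`, because it contains `∇V_S`; existence thus rests on Peano's
theorem, and the estimates hold for every solution without uniqueness. -/

/-! ### Peano's existence theorem -/

/-- **Euler polygons.** If the vector field is within `ε` of a constant vector `v` at each of the
nodes concerned, the increment of the Euler scheme is within `ε` times the elapsed time of the
increment of the motion with velocity `v`. -/
theorem norm_euler_sub_le {E : Type*} [NormedAddCommGroup E] [NormedSpace ℝ E] {F : E → E}
    {h ε : ℝ} (hh : 0 ≤ h) {z : ℕ → E} (hz : ∀ k, z (k + 1) = z k + h • F (z k)) (v : E) (k j : ℕ)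
    (H : ∀ i < j, ‖F (z (k + i)) - v‖ ≤ ε) :
    ‖z (k + j) - z k - (j * h) • v‖ ≤ j * h * ε := by
  induction j with
  | zero => simp
  | succ j ih =>
    have h1 := ih fun i hi => H i (by omega)
    have h2 : ‖h • (F (z (k + j)) - v)‖ ≤ h * ε := by
      rw [norm_smul, Real.norm_of_nonneg hh]
      exact mul_le_mul_of_nonneg_left (H j (by omega)) hh
    have h3 : z (k + (j + 1)) - z k - (((j + 1 : ℕ) : ℝ) * h) • v
        = (z (k + j) - z k - (j * h) • v) + h • (F (z (k + j)) - v) := by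
      rw [← add_assoc, hz]; push_cast; module
    rw [h3]
    refine (norm_add_le _ _).trans ?_
    push_cast; linarith

/-- **Peano's existence theorem** for a bounded continuous vector field, globally in time. -/
theorem exists_isIntegralCurveOn_of_continuous_of_bounded {E : Type*} [NormedAddCommGroup E]
    [NormedSpace ℝ E] [ProperSpace E] {F : E → E} (hF : Continuous F) {K : ℝ}
    (hK : ∀ x, ‖F x‖ ≤ K) (x₀ : E) :
    ∃ y : ℝ → E, y 0 = x₀ ∧ IsIntegralCurveOn y (fun _ => F) (Set.Ici 0) := by
  have hK0 : 0 ≤ K := (norm_nonneg _).trans (hK x₀)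
  let h : ℕ → ℝ := fun n => 1 / ((n : ℝ) + 1)
  have hh : ∀ n, 0 < h n := fun n => Nat.one_div_pos_of_nat
  have hh1 : ∀ n : ℕ, h n * ((n : ℝ) + 1) = 1 := fun n => by
    have : (n : ℝ) + 1 ≠ 0 := by positivity
    simp only [h]; field_simp
  let z : ℕ → ℕ → E := fun n k => (fun x => x + h n • F x)^[k] x₀
  have hz : ∀ n k, z n (k + 1) = z n k + h n • F (z n k) := fun n k => by
    simp only [z, Function.iterate_succ_apply']
  let N : ℕ → ℝ → ℕ := fun n t => ⌊t * ((n : ℝ) + 1)⌋₊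
  let Y : ℕ → ℝ → E := fun n t => z n (N n t)
  have hN : ∀ n : ℕ, ∀ a b : ℝ, 0 ≤ a → a ≤ b → ∃ j : ℕ, N n b = N n a + j ∧
      |j * h n - (b - a)| ≤ h n := by
    intro n a b ha hab
    have hn : (0 : ℝ) < (n : ℝ) + 1 := by positivity
    have hle : N n a ≤ N n b := Nat.floor_mono (by gcongr)
    obtain ⟨j, hj⟩ := Nat.exists_eq_add_of_le hle
    refine ⟨j, hj, ?_⟩
    have a1 := Nat.floor_le (a := a * ((n : ℝ) + 1)) (by positivity)
    have a2 := Nat.lt_floor_add_one (a * ((n : ℝ) + 1))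
    have b1 := Nat.floor_le (a := b * ((n : ℝ) + 1)) (by have := ha.trans hab; positivity)
    have b2 := Nat.lt_floor_add_one (b * ((n : ℝ) + 1))
    have hj' : (N n b : ℝ) = N n a + j := by exact_mod_cast hj
    have e : |(j : ℝ) - (b - a) * ((n : ℝ) + 1)| ≤ 1 := by
      rw [abs_le]; simp only [N] at hj'; constructor <;> linarith
    calc |j * h n - (b - a)| = |(j - (b - a) * ((n : ℝ) + 1)) * h n| := by
          congr 1; linear_combination (b - a) * hh1 n
      _ = |(j : ℝ) - (b - a) * ((n : ℝ) + 1)| * h n := by rw [abs_mul, abs_of_pos (hh n)]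
      _ ≤ 1 * h n := mul_le_mul_of_nonneg_right e (hh n).le
      _ = h n := one_mul _
  have hzK : ∀ n k j, ‖z n (k + j) - z n k‖ ≤ j * h n * K := fun n k j => by
    simpa using norm_euler_sub_le (hh n).le (hz n) 0 k j (fun i _ => by simpa using hK _)
  have hYK : ∀ n a b, 0 ≤ a → a ≤ b → ‖Y n b - Y n a‖ ≤ K * (b - a + h n) := by
    intro n a b ha hab
    obtain ⟨j, hj, hj'⟩ := hN n a b ha hab
    simp only [Y, hj]
    refine (hzK n _ j).trans ?_
    rw [mul_comm]
    gcongr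
    linarith [(abs_le.1 hj').2]
  have hY0 : ∀ n, Y n 0 = x₀ := fun n => by simp [Y, N, z]
  -- An ultrafilter replaces the Arzelà–Ascoli subsequence: a bounded sequence in a proper space
  -- converges along it, so the step functions `Y n` converge at all times simultaneously.
  let U : Ultrafilter ℕ := Filter.hyperfilter ℕ
  have hU : (U : Filter ℕ) ≤ Filter.atTop := Nat.hyperfilter_le_atTop
  have hh0 : Filter.Tendsto h U (𝓝 0) := tendsto_one_div_add_atTop_nhds_zero_nat.mono_left hU
  have hlim : ∀ t, 0 ≤ t → ∃ p, Filter.Tendsto (fun n => Y n t) U (𝓝 p) := by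
    intro t ht
    have hc := isCompact_closedBall x₀ (K * (t + 1))
    obtain ⟨p, -, hp⟩ := hc.ultrafilter_le_nhds' (U.map fun n => Y n t) (by
      refine Filter.Eventually.of_forall (p := fun n => Y n t ∈ Metric.closedBall x₀ _) fun n => ?_
      simp only [Metric.mem_closedBall, dist_eq_norm]
      have := hYK n 0 t le_rfl ht
      rw [hY0] at this
      have h1 : h n ≤ 1 := by
        simp only [h]; rw [div_le_one (by positivity)]; linarith [(Nat.cast_nonneg n : (0:ℝ) ≤ n)]
      exact this.trans (mul_le_mul_of_nonneg_left (by linarith) hK0))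
    exact ⟨p, hp⟩
  choose! y hy using hlim
  refine ⟨y, ?_, ?_⟩
  · refine tendsto_nhds_unique (hy 0 le_rfl) ?_
    simp only [hY0]; exact tendsto_const_nhds
  have hyK : ∀ a b, 0 ≤ a → a ≤ b → ‖y b - y a‖ ≤ K * (b - a) := by
    intro a b ha hab
    have h1 := ((hy b (ha.trans hab)).sub (hy a ha)).norm
    have h2 : Filter.Tendsto (fun n => K * (b - a + h n)) U (𝓝 (K * (b - a))) := by
      simpa using (hh0.const_add (b - a)).const_mul K
    exact le_of_tendsto_of_tendsto' h1 h2 fun n => hYK n a b ha hab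
  -- As long as the polygons stay where `F` is `ε`-close to `F p`, they move with velocity nearly `F
  -- p`, and this survives the limit. With `p = y s` it is the derivative at `s`. The base point `p`
  -- is kept apart from `y a` so that intervals ending at `s` are covered too.
  have key : ∀ (p : E) (ε δ : ℝ), 0 ≤ ε → (∀ x, ‖x - p‖ < δ → ‖F x - F p‖ ≤ ε) →
      ∀ a b, 0 ≤ a → a ≤ b → K * (b - a) + ‖y a - p‖ < δ →
      ‖y b - y a - (b - a) • F p‖ ≤ ε * (b - a) := by
    intro p ε δ hε H a b ha hab hlt
    have t1 : Filter.Tendsto (fun n => ‖Y n b - Y n a - (b - a) • F p‖) U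
        (𝓝 ‖y b - y a - (b - a) • F p‖) :=
      (((hy b (ha.trans hab)).sub (hy a ha)).sub_const _).norm
    have t2 : Filter.Tendsto (fun n => ε * (b - a + h n) + h n * K) U (𝓝 (ε * (b - a))) := by
      simpa using ((hh0.const_add (b - a)).const_mul ε).add (hh0.mul_const K)
    have t3 : Filter.Tendsto (fun n => K * (b - a + h n) + ‖Y n a - p‖) U
        (𝓝 (K * (b - a) + ‖y a - p‖)) := by
      simpa using ((hh0.const_add (b - a)).const_mul K).add ((hy a ha).sub_const p).norm
    refine le_of_tendsto_of_tendsto t1 t2 ?_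
    filter_upwards [t3.eventually_lt_const hlt] with n hn
    obtain ⟨j, hj, hj'⟩ := hN n a b ha hab
    have hj2 := (abs_le.1 hj').2
    have hjh : j * h n ≤ b - a + h n := by linarith
    have e1 := norm_euler_sub_le (hh n).le (hz n) (F p) (N n a) j (ε := ε) (by
      intro i hi
      apply H
      have : ‖z n (N n a + i) - z n (N n a)‖ ≤ K * (b - a + h n) := by
        refine (hzK n _ i).trans ?_
        rw [mul_comm]
        gcongr
        refine le_trans ?_ hjh
        have := (hh n).le
        gcongr
      calc ‖z n (N n a + i) - p‖ = ‖(z n (N n a + i) - z n (N n a)) + (Y n a - p)‖ := by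
            simp only [Y]; congr 1; abel
        _ ≤ _ := norm_add_le _ _
        _ < δ := by linarith)
    have e2 : Y n b - Y n a - (b - a) • F p
        = (z n (N n a + j) - z n (N n a) - (j * h n) • F p) + (j * h n - (b - a)) • F p := by
      simp only [Y, hj]; module
    have e3 : ‖(j * h n - (b - a)) • F p‖ ≤ h n * K := by
      rw [norm_smul]
      exact mul_le_mul hj' (hK p) (norm_nonneg _) (hh n).le
    have e4 : j * h n * ε ≤ ε * (b - a + h n) := by
      rw [mul_comm]; gcongr
    rw [e2]
    exact (norm_add_le _ _).trans (by linarith)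
  intro s hs
  rw [hasDerivWithinAt_iff_isLittleO, Asymptotics.isLittleO_iff]
  intro ε hε
  obtain ⟨δ, hδ, H⟩ := Metric.continuousAt_iff.1 (hF.continuousAt (x := y s)) ε hε
  have H' : ∀ x, ‖x - y s‖ < δ → ‖F x - F (y s)‖ ≤ ε := fun x hx => by
    simpa [dist_eq_norm] using (H (by simpa [dist_eq_norm] using hx)).le
  -- The factor 2 is for `t < s`: the polygon starts at `y t`, already up to `K * |t - s|` away from
  -- `y s`, and may move as far again.
  have hev : ∀ᶠ t in 𝓝[Set.Ici 0] s, 2 * (K * |t - s|) < δ := by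
    have : Filter.Tendsto (fun t => 2 * (K * |t - s|)) (𝓝 s) (𝓝 (2 * (K * |s - s|))) :=
      Continuous.tendsto (by fun_prop) s
    exact (this.mono_left nhdsWithin_le_nhds).eventually_lt_const (by simpa using hδ)
  filter_upwards [hev, self_mem_nhdsWithin] with t ht ht0
  rw [Real.norm_eq_abs]
  have hnn : 0 ≤ K * |t - s| := by positivity
  rcases le_total s t with hst | hts
  · rw [abs_of_nonneg (sub_nonneg.2 hst)] at *
    exact key (y s) ε δ hε.le H' s t hs hst (by simp; linarith)
  · rw [abs_sub_comm, abs_of_nonneg (sub_nonneg.2 hts)] at *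
    have h1 := key (y s) ε δ hε.le H' t s ht0 hts (by
      have := hyK t s ht0 hts
      rw [norm_sub_rev] at this
      linarith)
    rw [show y t - y s - (t - s) • F (y s) = -(y s - y t - (s - t) • F (y s)) by module, norm_neg]
    exact h1

/-! ### Lyapunov functions for continuous fields -/

section Lyapunov

variable {E : Type*} [NormedAddCommGroup E] [NormedSpace ℝ E] {F : E → E} {W : E → ℝ}
  {W' : E → E →L[ℝ] ℝ} {C c ρ : ℝ}

/-- Exponential decay of a quadratically bounded Lyapunov function along a solution, for as long as
the solution stays in the region where the decay condition holds. -/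
theorem IsIntegralCurveOn.lyapunov_mul_exp_le (hC : 0 < C) (hc : 0 < c)
    (hW : ∀ x, HasFDerivAt W (W' x) x) (hW2 : ∀ x, W x ≤ C * ‖x‖ ^ 2)
    (hWF : ∀ x, ‖x‖ ≤ ρ → W' x (F x) ≤ -c * ‖x‖ ^ 2) {T : ℝ} {y : ℝ → E}
    (hy : IsIntegralCurveOn y (fun _ => F) (Set.Ico 0 T)) {τ : ℝ} (hτ0 : 0 ≤ τ) (hτ : τ < T)
    (hyρ : ∀ t ∈ Set.Ico 0 τ, ‖y t‖ ≤ ρ) :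
    W (y τ) * Real.exp (c / C * τ) ≤ W (y 0) := by
  have hd : ∀ t ∈ Set.Ioo 0 τ, HasDerivAt (fun t => W (y t) * Real.exp (c / C * t))
      (W' (y t) (F (y t)) * Real.exp (c / C * t)
        + W (y t) * (Real.exp (c / C * t) * (c / C))) t := by
    intro t ht
    have h1 : HasDerivAt y (F (y t)) t :=
      (hy t ⟨ht.1.le, ht.2.trans hτ⟩).hasDerivAt (Ico_mem_nhds ht.1 (ht.2.trans hτ))
    have h2 : HasDerivAt (fun t => W (y t)) (W' (y t) (F (y t))) t := (hW (y t)).comp_hasDerivAt t h1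
    have h3 : HasDerivAt (fun t => Real.exp (c / C * t)) (Real.exp (c / C * t) * (c / C)) t := by
      simpa using ((hasDerivAt_id t).const_mul (c / C)).exp
    exact h2.mul h3
  have hWc : Continuous W := continuous_iff_continuousAt.2 fun x => (hW x).continuousAt
  have hyc : ContinuousOn y (Set.Icc 0 τ) := fun t ht =>
    (hy t ⟨ht.1, ht.2.trans_lt hτ⟩).continuousWithinAt.mono
      fun s hs => ⟨hs.1, hs.2.trans_lt hτ⟩
  have hanti : AntitoneOn (fun t => W (y t) * Real.exp (c / C * t)) (Set.Icc 0 τ) := by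
    refine antitoneOn_of_deriv_nonpos (convex_Icc 0 τ) ?_ ?_ ?_
    · exact (hWc.comp_continuousOn hyc).mul (by fun_prop)
    · rw [interior_Icc]
      exact fun t ht => (hd t ht).differentiableAt.differentiableWithinAt
    · rw [interior_Icc]
      intro t ht
      rw [(hd t ht).deriv]
      have h1 := hWF _ (hyρ t ⟨ht.1.le, ht.2⟩)
      have h2 : c / C * W (y t) ≤ c * ‖y t‖ ^ 2 := by
        calc c / C * W (y t) ≤ c / C * (C * ‖y t‖ ^ 2) := by gcongr; exact hW2 _
          _ = c * ‖y t‖ ^ 2 := by field_simp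
      have h3 := Real.exp_pos (c / C * t)
      have h4 : W' (y t) (F (y t)) + c / C * W (y t) ≤ 0 := by linarith
      calc _ = (W' (y t) (F (y t)) + c / C * W (y t)) * Real.exp (c / C * t) := by ring
        _ ≤ 0 := mul_nonpos_of_nonpos_of_nonneg h4 h3.le
  simpa using hanti (Set.left_mem_Icc.2 hτ0) (Set.right_mem_Icc.2 hτ0) hτ0

/-- Solutions starting close to the origin stay close to it, if there is a quadratically bounded
Lyapunov function. -/
theorem IsIntegralCurveOn.norm_lt_of_lyapunov (hC : 0 < C) (hc : 0 < c)
    (hW : ∀ x, HasFDerivAt W (W' x) x) (hW1 : ∀ x, ‖x‖ ^ 2 ≤ W x)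
    (hW2 : ∀ x, W x ≤ C * ‖x‖ ^ 2)
    (hWF : ∀ x, ‖x‖ ≤ ρ → W' x (F x) ≤ -c * ‖x‖ ^ 2) {T : ℝ} {y : ℝ → E}
    (hy : IsIntegralCurveOn y (fun _ => F) (Set.Ico 0 T)) {ε : ℝ} (hε : 0 < ε) (hερ : ε ≤ ρ)
    (hy0 : ‖y 0‖ < ε / (C + 1)) {t : ℝ} (ht : t ∈ Set.Ico 0 T) : ‖y t‖ < ε := by
  by_contra! hlt
  -- The radius `ε / (C + 1)` suffices because `C < (C + 1) ^ 2`.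
  have hW0 : W (y 0) < ε ^ 2 := by
    calc W (y 0) ≤ C * ‖y 0‖ ^ 2 := hW2 _
      _ ≤ C * (ε / (C + 1)) ^ 2 := by gcongr
      _ = ε ^ 2 * (C / (C + 1) ^ 2) := by rw [div_pow]; ring
      _ < ε ^ 2 * 1 := by
        gcongr
        rw [div_lt_one (by positivity)]
        nlinarith
      _ = ε ^ 2 := mul_one _
  have hyc : ContinuousOn (fun s => ‖y s‖) (Set.Icc 0 t) := ContinuousOn.norm fun s hs =>
    (hy s ⟨hs.1, hs.2.trans_lt ht.2⟩).continuousWithinAt.mono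
      fun s hs => ⟨hs.1, hs.2.trans_lt ht.2⟩
  have hcomp : IsCompact (Set.Icc 0 t ∩ (fun s => ‖y s‖) ⁻¹' Set.Ici ε) :=
    isCompact_Icc.of_isClosed_subset
      (hyc.preimage_isClosed_of_isClosed isClosed_Icc isClosed_Ici) Set.inter_subset_left
  -- At the first time `τ` with norm at least `ε`, the decay estimate still applies, since it needs
  -- the bound only before `τ`; it contradicts `W (y 0) < ε ^ 2`.
  obtain ⟨τ, ⟨hτ, hτε⟩, hleast⟩ := hcomp.exists_isLeast ⟨t, ⟨ht.1, le_rfl⟩, hlt⟩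
  have hτε' : ε ≤ ‖y τ‖ := hτε
  have key := hy.lyapunov_mul_exp_le hC hc hW hW2 hWF hτ.1 (hτ.2.trans_lt ht.2) (by
    intro s hs
    by_contra! hs'
    exact absurd (hleast ⟨⟨hs.1, hs.2.le.trans hτ.2⟩, hερ.trans hs'.le⟩) (not_le.2 hs.2))
  have hexp : 1 ≤ Real.exp (c / C * τ) := Real.one_le_exp (by have := hτ.1; positivity)
  have h1 : ε ^ 2 ≤ W (y τ) := (pow_le_pow_left₀ hε.le hτε' 2).trans (hW1 _)
  nlinarith [sq_nonneg ε]

/-- **Lyapunov's theorem** for a continuous vector field, with a Lyapunov function that is bounded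
above and below by multiples of the squared norm. -/
theorem SDRE.LocallyAsymptoticallyStable.of_lyapunov [ProperSpace E] (hC : 0 < C) (hc : 0 < c)
    (hρ : 0 < ρ) (hF0 : F 0 = 0) (hF : ContinuousOn F (Metric.closedBall 0 ρ))
    (hW : ∀ x, HasFDerivAt W (W' x) x) (hW1 : ∀ x, ‖x‖ ^ 2 ≤ W x)
    (hW2 : ∀ x, W x ≤ C * ‖x‖ ^ 2)
    (hWF : ∀ x, ‖x‖ ≤ ρ → W' x (F x) ≤ -c * ‖x‖ ^ 2) :
    SDRE.LocallyAsymptoticallyStable F := by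
  refine ⟨hF0, fun ε hε => ?_, ρ / (C + 1), by positivity, fun y hy0 hy => ?_⟩
  · have hε' : 0 < min ε ρ := lt_min hε hρ
    refine ⟨min ε ρ / (C + 1), by positivity, fun x hx => ⟨?_, fun T y hyx hy t ht => ?_⟩⟩
    -- Radial retraction onto the ball of radius `ρ`: `F ∘ π` is bounded and continuous, so Peano
    -- applies, and its solution never leaves the ball, where `F ∘ π = F`.
    · let π : E → E := fun x => (ρ / max ρ ‖x‖) • x
      have hmax : ∀ x : E, 0 < max ρ ‖x‖ := fun x => lt_max_of_lt_left hρ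
      have hπc : Continuous π :=
        (continuous_const.div (by fun_prop) fun x => (hmax x).ne').smul continuous_id
      have hπρ : ∀ x, π x ∈ Metric.closedBall (0 : E) ρ := by
        intro x
        rw [mem_closedBall_zero_iff, norm_smul, Real.norm_of_nonneg (by have := hmax x; positivity),
          div_mul_eq_mul_div, div_le_iff₀ (hmax x)]
        exact mul_le_mul_of_nonneg_left (le_max_right _ _) hρ.le
      have hπid : ∀ x, ‖x‖ ≤ ρ → π x = x := by
        intro x hx
        simp only [π, max_eq_left hx, div_self hρ.ne', one_smul]
      obtain ⟨K, hK⟩ := (isCompact_closedBall (0 : E) ρ).exists_bound_of_continuousOn hF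
      obtain ⟨y, hyx, hy⟩ := exists_isIntegralCurveOn_of_continuous_of_bounded
        (hF.comp_continuous hπc hπρ) (fun x => hK _ (hπρ x)) x
      have hlt : ∀ t, 0 ≤ t → ‖y t‖ < min ε ρ := by
        intro t ht
        refine IsIntegralCurveOn.norm_lt_of_lyapunov (ρ := ρ) (T := t + 1) (F := fun x => F (π x))
          hC hc hW hW1 hW2 ?_ (hy.mono Set.Ico_subset_Ici_self) hε' (min_le_right _ _)
          (by rwa [hyx]) ⟨ht, lt_add_one t⟩
        intro x hx
        simp only [hπid x hx]
        exact hWF x hx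
      refine ⟨y, hyx, fun t ht => ?_⟩
      have : HasDerivWithinAt y (F (π (y t))) (Set.Ici 0) t := hy t ht
      rwa [hπid _ ((hlt t ht).le.trans (min_le_right _ _))] at this
    · exact (hy.norm_lt_of_lyapunov hC hc hW hW1 hW2 hWF hε' (min_le_right _ _)
        (by rwa [hyx]) ht).trans_le (min_le_left _ _)
  · have hlt : ∀ t, 0 ≤ t → ‖y t‖ < ρ := fun t ht =>
      IsIntegralCurveOn.norm_lt_of_lyapunov (T := t + 1) hC hc hW hW1 hW2 hWF
        (hy.mono Set.Ico_subset_Ici_self) hρ le_rfl hy0 ⟨ht, lt_add_one t⟩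
    have hdecay : ∀ t, 0 ≤ t → ‖y t‖ ^ 2 ≤ W (y 0) * Real.exp (-(c / C * t)) := by
      intro t ht
      have h1 := IsIntegralCurveOn.lyapunov_mul_exp_le (T := t + 1) hC hc hW hW2 hWF
        (hy.mono Set.Ico_subset_Ici_self) ht (lt_add_one t) (fun s hs => (hlt s hs.1).le)
      rw [Real.exp_neg, ← div_eq_mul_inv, le_div_iff₀ (Real.exp_pos _)]
      exact (mul_le_mul_of_nonneg_right (hW1 _) (Real.exp_pos _).le).trans h1
    have hlim : Filter.Tendsto (fun t => W (y 0) * Real.exp (-(c / C * t))) Filter.atTop (𝓝 0) := by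
      have : Filter.Tendsto (fun t : ℝ => c / C * t) Filter.atTop Filter.atTop :=
        Filter.tendsto_id.const_mul_atTop (by positivity)
      simpa using (Real.tendsto_exp_neg_atTop_nhds_zero.comp this).const_mul (W (y 0))
    have hsq : Filter.Tendsto (fun t => ‖y t‖ ^ 2) Filter.atTop (𝓝 0) :=
      squeeze_zero' (Filter.Eventually.of_forall fun t => by positivity)
        ((Filter.eventually_ge_atTop 0).mono hdecay) hlim
    rw [tendsto_zero_iff_norm_tendsto_zero]
    simpa [Real.sqrt_sq] using hsq.sqrt

end Lyapunov

/-! ### Stable matrices and quadratic Lyapunov functions -/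

open scoped Matrix.Norms.L2Operator in
/-- The powers of a complex matrix all of whose eigenvalues lie in the open unit disc tend to
zero. -/
theorem Matrix.tendsto_pow_atTop_nhds_zero_of_spectrum {d : ℕ} (N : Matrix (Fin d) (Fin d) ℂ)
    (hN : ∀ z ∈ spectrum ℂ N, ‖z‖ < 1) :
    Filter.Tendsto (fun n => N ^ n) Filter.atTop (𝓝 0) := by
  have hrad : spectralRadius ℂ N < 1 := by
    -- The spectrum is empty when `d = 0`. Otherwise its compactness makes the bound strict, and
    -- Gelfand's formula then gives geometric decay.
    rcases (spectrum ℂ N).eq_empty_or_nonempty with h | h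
    · simp [spectralRadius, h]
    · have := spectrum.spectralRadius_lt_of_forall_lt_of_nonempty h (r := 1)
        (fun z hz => by exact_mod_cast hN z hz)
      simpa using this
  obtain ⟨q, hq, hq1⟩ := ENNReal.lt_iff_exists_nnreal_btwn.1 hrad
  have hq1' : q < 1 := by exact_mod_cast hq1
  have hlt := (spectrum.pow_nnnorm_pow_one_div_tendsto_nhds_spectralRadius N).eventually_lt_const hq
  rw [tendsto_zero_iff_norm_tendsto_zero]
  refine squeeze_zero' (Filter.Eventually.of_forall fun n => norm_nonneg _) ?_
    (tendsto_pow_atTop_nhds_zero_of_lt_one q.2 (by exact_mod_cast hq1'))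
  filter_upwards [hlt, Filter.eventually_gt_atTop 0] with n hn hn0
  have h1 : (‖N ^ n‖₊ : ENNReal) ≤ (q : ENNReal) ^ n := by
    have h2 := ENNReal.rpow_le_rpow hn.le (Nat.cast_nonneg n)
    rwa [← ENNReal.rpow_mul, one_div_mul_cancel (by positivity), ENNReal.rpow_one,
      ENNReal.rpow_natCast] at h2
  exact_mod_cast h1

/-- A complex number in the spectrum of a matrix is an eigenvalue. -/
theorem Matrix.exists_mulVec_eq_smul_of_mem_spectrum {d : ℕ} {N : Matrix (Fin d) (Fin d) ℂ}
    {z : ℂ} (hz : z ∈ spectrum ℂ N) : ∃ v ≠ 0, N *ᵥ v = z • v := by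
  rw [← Matrix.spectrum_toLin', ← Module.End.hasEigenvalue_iff_mem_spectrum] at hz
  obtain ⟨v, hv⟩ := hz.exists_hasEigenvector
  exact ⟨v, hv.2, by simpa using hv.apply_eq_smul⟩

theorem Matrix.mem_spectrum_of_mulVec_eq_smul {d : ℕ} {N : Matrix (Fin d) (Fin d) ℂ}
    {z : ℂ} {v : Fin d → ℂ} (hv : v ≠ 0) (h : N *ᵥ v = z • v) : z ∈ spectrum ℂ N := by
  rw [← Matrix.spectrum_toLin', ← Module.End.hasEigenvalue_iff_mem_spectrum]
  exact Module.End.hasEigenvalue_of_hasEigenvector (x := v)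
    ⟨Module.End.mem_eigenspace_iff.2 (by simpa using h), hv⟩

/-- The Cayley transform of a stable matrix is a well-defined matrix with powers tending to
zero. -/
theorem SDRE.IsHurwitz.exists_cayley {d : ℕ} {M : Matrix (Fin d) (Fin d) ℝ}
    (hM : SDRE.IsHurwitz M) :
    ∃ S N : Matrix (Fin d) (Fin d) ℝ, S * (1 - M) = 1 ∧ N * (1 - M) = 1 + M ∧
      Filter.Tendsto (fun n => N ^ n) Filter.atTop (𝓝 0) := by
  let φ := Complex.ofRealHom.mapMatrix (m := Fin d)
  have hu : IsUnit (1 - M) := by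
    rw [Matrix.isUnit_iff_isUnit_det, isUnit_iff_ne_zero]
    intro h0
    have h1 : (1 - φ M).det = 0 := by
      have : (φ (1 - M)).det = 0 := by
        rw [← RingHom.map_det, h0, map_zero]
      rwa [map_sub, map_one] at this
    obtain ⟨v, hv, hv'⟩ := Matrix.exists_mulVec_eq_zero_iff.2 h1
    have h2 : (1 : ℂ) ∈ spectrum ℂ (φ M) := by
      refine Matrix.mem_spectrum_of_mulVec_eq_smul hv ?_
      rw [Matrix.sub_mulVec, Matrix.one_mulVec, sub_eq_zero] at hv'
      rw [one_smul, ← hv']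
    have := hM 1 h2
    norm_num at this
  obtain ⟨u, hu⟩ := hu
  have huS : (↑u⁻¹ : Matrix (Fin d) (Fin d) ℝ) * (1 - M) = 1 := by rw [← hu, u.inv_mul]
  have huS' : (1 - M) * (↑u⁻¹ : Matrix (Fin d) (Fin d) ℝ) = 1 := by rw [← hu, u.mul_inv]
  set S : Matrix (Fin d) (Fin d) ℝ := ↑u⁻¹
  refine ⟨S, (1 + M) * S, huS, by rw [mul_assoc, huS, mul_one], ?_⟩
  set N := (1 + M) * S
  have key : Filter.Tendsto (fun n => (φ N) ^ n) Filter.atTop (𝓝 0) := by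
    refine Matrix.tendsto_pow_atTop_nhds_zero_of_spectrum _ fun z hz => ?_
    obtain ⟨w, hw, hzw⟩ := Matrix.exists_mulVec_eq_smul_of_mem_spectrum hz
    set v := φ S *ᵥ w
    have hwv : w = v - φ M *ᵥ v := by
      have h1 : (1 - φ M) * φ S = 1 := by
        have := congrArg φ huS'
        simpa using this
      calc w = ((1 - φ M) * φ S) *ᵥ w := by rw [h1, Matrix.one_mulVec]
        _ = _ := by rw [← Matrix.mulVec_mulVec, Matrix.sub_mulVec, Matrix.one_mulVec]
    have hNw : φ N *ᵥ w = v + φ M *ᵥ v := by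
      simp only [N, map_mul, map_add, map_one]
      rw [← Matrix.mulVec_mulVec, Matrix.add_mulVec, Matrix.one_mulVec]
    have hv : v ≠ 0 := by
      intro h0; apply hw; rw [hwv, h0]; simp
    -- An eigenvector `w = (1 - M) v` of `N` for `z` makes `v` an eigenvector of `M` for `(z - 1) /
    -- (1 + z)`, whose real part is negative exactly when `‖z‖ < 1`.
    have h3 : (1 + z) • (φ M *ᵥ v) = (z - 1) • v := by
      rw [hNw, hwv] at hzw
      linear_combination (norm := module) hzw
    have hz1 : 1 + z ≠ 0 := by
      intro h0
      rw [h0, zero_smul] at h3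
      have : z - 1 = 0 := by
        rcases smul_eq_zero.1 h3.symm with h | h
        · exact h
        · exact absurd h hv
      have h2 : (2 : ℂ) = 0 := by linear_combination h0 - this
      norm_num at h2
    have hlam : (z - 1) / (1 + z) ∈ spectrum ℂ (φ M) := by
      refine Matrix.mem_spectrum_of_mulVec_eq_smul hv ?_
      rw [div_eq_inv_mul, mul_smul, ← h3, smul_smul, inv_mul_cancel₀ hz1, one_smul]
    have hre := hM _ hlam
    have hpos : 0 < Complex.normSq (1 + z) := Complex.normSq_pos.2 hz1
    rw [Complex.div_re, ← add_div, div_neg_iff] at hre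
    have h4 : Complex.normSq z < 1 := by
      rcases hre with h | h
      · linarith [h.2]
      · have := h.1
        simp only [Complex.sub_re, Complex.add_re, Complex.one_re, Complex.sub_im, Complex.add_im,
          Complex.one_im] at this
        rw [Complex.normSq_apply]; linarith
    rw [Complex.normSq_eq_norm_sq] at h4
    nlinarith [norm_nonneg z]
  refine tendsto_pi_nhds.2 fun i => tendsto_pi_nhds.2 fun j => ?_
  have h1 := ((tendsto_pi_nhds.1 ((tendsto_pi_nhds.1 key) i)) j)
  have h2 := (Complex.continuous_re.tendsto _).comp h1
  simp only [← map_pow] at h2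
  exact h2

open scoped RealInnerProductSpace in
/-- **Lyapunov's theorem for stable matrices**: a linear system with stable matrix has a quadratic
Lyapunov function. -/
theorem SDRE.IsHurwitz.exists_lyapunov {d : ℕ} {M : Matrix (Fin d) (Fin d) ℝ}
    (hM : SDRE.IsHurwitz M) :
    ∃ (W : EuclideanSpace ℝ (Fin d) → ℝ)
      (W' : EuclideanSpace ℝ (Fin d) → EuclideanSpace ℝ (Fin d) →L[ℝ] ℝ) (C L c : ℝ),
      0 < C ∧ 0 < L ∧ 0 < c ∧ (∀ x, HasFDerivAt W (W' x) x) ∧ (∀ x, ‖x‖ ^ 2 ≤ W x) ∧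
      (∀ x, W x ≤ C * ‖x‖ ^ 2) ∧ (∀ x, ‖W' x‖ ≤ L * ‖x‖) ∧
      ∀ x, W' x (Matrix.toEuclideanCLM (𝕜 := ℝ) M x) ≤ -c * ‖x‖ ^ 2 := by
  obtain ⟨S, N, hS, hN, hlim⟩ := hM.exists_cayley
  let Φ := Matrix.toEuclideanCLM (n := Fin d) (𝕜 := ℝ)
  have hΦc : Continuous Φ := Φ.toAlgEquiv.toLinearMap.continuous_of_finiteDimensional
  have hlim' : Filter.Tendsto (fun n => ‖Φ N ^ n‖) Filter.atTop (𝓝 0) := by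
    have := ((hΦc.tendsto 0).comp hlim).norm
    simpa using this
  obtain ⟨n, hn, hn0⟩ := ((hlim'.eventually_lt_const (u := 1 / 2) (by norm_num)).and
    (Filter.eventually_gt_atTop 0)).exists
  set T := Φ N
  set s := Φ S
  set μ := Φ M
  have hs : ∀ x, s (x - μ x) = x := by
    intro x
    have := congrArg Φ hS
    rw [map_mul, map_sub, map_one] at this
    simpa using congrArg (fun G => G x) this
  have hTx : ∀ x, T (x - μ x) = x + μ x := by
    intro x
    have := congrArg Φ hN
    rw [map_mul, map_sub, map_add, map_one] at this
    simpa using congrArg (fun G => G x) this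
  -- A finite sum suffices: under `T` it telescopes to `‖T ^ n x‖ ^ 2 - ‖x‖ ^ 2`, and `‖T ^ n‖ < 1 /
  -- 2` yields the constant `3 / 4`.
  let W : EuclideanSpace ℝ (Fin d) → ℝ := fun x => ∑ k ∈ Finset.range n, ‖(T ^ k) x‖ ^ 2
  let W' : EuclideanSpace ℝ (Fin d) → EuclideanSpace ℝ (Fin d) →L[ℝ] ℝ := fun x =>
    ∑ k ∈ Finset.range n, (2 : ℝ) • (innerSL ℝ ((T ^ k) x)).comp (T ^ k)
  have hstep : ∀ x, W (T x) - W x ≤ -(3 / 4) * ‖x‖ ^ 2 := by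
    intro x
    have h1 : W (T x) - W x = ‖(T ^ n) x‖ ^ 2 - ‖x‖ ^ 2 := by
      have := Finset.sum_range_sub (fun k => ‖(T ^ k) x‖ ^ 2) n
      simp only [W]
      rw [← Finset.sum_sub_distrib]
      simpa [pow_succ] using this
    have h2 : ‖(T ^ n) x‖ ≤ 1 / 2 * ‖x‖ :=
      ((T ^ n).le_opNorm x).trans (mul_le_mul_of_nonneg_right hn.le (norm_nonneg _))
    have h3 := pow_le_pow_left₀ (norm_nonneg _) h2 2
    rw [h1]; nlinarith
  -- Polarization turns the derivative along `μ` into a difference of `W` at `x + μ x` and `x - μ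
  -- x`; the Cayley transform `T` maps the second point to the first, so discrete decay becomes
  -- continuous decay.
  have hpol : ∀ x, W' x (μ x) = (1 / 2) * (W (T (x - μ x)) - W (x - μ x)) := by
    intro x
    rw [hTx]
    simp only [W, W', ← Finset.sum_sub_distrib, Finset.mul_sum, sum_apply]
    refine Finset.sum_congr rfl fun k _ => ?_
    simp only [map_add, map_sub, smul_apply, ContinuousLinearMap.comp_apply,
      innerSL_apply_apply, smul_eq_mul]
    rw [norm_add_sq_real, norm_sub_sq_real]
    ring
  have hsx : ∀ x, ‖x‖ ^ 2 ≤ (‖s‖ ^ 2 + 1) * ‖x - μ x‖ ^ 2 := by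
    intro x
    have h1 := s.le_opNorm (x - μ x)
    rw [hs] at h1
    have h2 := pow_le_pow_left₀ (norm_nonneg _) h1 2
    nlinarith [sq_nonneg ‖x - μ x‖]
  refine ⟨W, W', ∑ k ∈ Finset.range n, ‖T ^ k‖ ^ 2 + 1, ∑ k ∈ Finset.range n, 2 * ‖T ^ k‖ ^ 2 + 1,
    3 / 8 / (‖s‖ ^ 2 + 1), by positivity, by positivity, by positivity, ?_, ?_, ?_, ?_, ?_⟩
  · intro x
    refine HasFDerivAt.fun_sum fun k _ => ?_
    simpa [two_smul] using ((T ^ k).hasFDerivAt (x := x)).norm_sq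
  · intro x
    have h0 : ‖x‖ ^ 2 = ‖(T ^ 0) x‖ ^ 2 := by simp
    rw [h0]
    exact Finset.single_le_sum (f := fun k => ‖(T ^ k) x‖ ^ 2) (fun k _ => by positivity)
      (Finset.mem_range.2 hn0)
  · intro x
    rw [add_mul, Finset.sum_mul]
    refine le_add_of_le_of_nonneg (Finset.sum_le_sum fun k _ => ?_) (by positivity)
    rw [← mul_pow]
    exact pow_le_pow_left₀ (norm_nonneg _) ((T ^ k).le_opNorm x) 2
  · intro x
    rw [add_mul, Finset.sum_mul]
    refine le_add_of_le_of_nonneg (norm_sum_le_of_le _ fun k _ => ?_) (by positivity)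
    rw [norm_smul, Real.norm_of_nonneg zero_le_two, mul_assoc]
    refine mul_le_mul_of_nonneg_left ?_ zero_le_two
    refine (ContinuousLinearMap.opNorm_comp_le _ _).trans ?_
    rw [innerSL_apply_norm]
    calc ‖(T ^ k) x‖ * ‖T ^ k‖ ≤ (‖T ^ k‖ * ‖x‖) * ‖T ^ k‖ := by
          gcongr; exact (T ^ k).le_opNorm x
      _ = _ := by ring
  · intro x
    have h1 := hstep (x - μ x)
    have h2 := hsx x
    have h3 : 3 / 8 / (‖s‖ ^ 2 + 1) * ‖x‖ ^ 2 ≤ 3 / 8 * ‖x - μ x‖ ^ 2 := by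
      rw [div_mul_eq_mul_div, div_le_iff₀ (by positivity)]
      linarith
    change W' x (μ x) ≤ _
    rw [hpol]
    linarith

/-! ### Stabilization by the Riccati solution -/

/-- Stability of a real matrix in terms of the real and imaginary parts of eigenvectors. -/
theorem SDRE.isHurwitz_iff_forall_real {d : ℕ} {M : Matrix (Fin d) (Fin d) ℝ} :
    SDRE.IsHurwitz M ↔ ∀ (α β : ℝ) (a b : Fin d → ℝ), M *ᵥ a = α • a - β • b →
      M *ᵥ b = β • a + α • b → α < 0 ∨ (a = 0 ∧ b = 0) := by
  constructor
  · intro hM α β a b ha hb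
    by_contra! h
    obtain ⟨hα, hab⟩ := h
    let v : Fin d → ℂ := fun i => ⟨a i, b i⟩
    have hv : v ≠ 0 := fun h0 => hab (funext fun i => congrArg Complex.re (congrFun h0 i))
      (funext fun i => congrArg Complex.im (congrFun h0 i))
    refine absurd (hM ⟨α, β⟩ (Matrix.mem_spectrum_of_mulVec_eq_smul hv ?_)) (not_lt.2 hα)
    funext i
    have hai := congrFun ha i
    have hbi := congrFun hb i
    simp only [Matrix.mulVec, dotProduct, Pi.sub_apply, Pi.add_apply, Pi.smul_apply,
      smul_eq_mul] at hai hbi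
    apply Complex.ext
    · simpa [Matrix.mulVec, dotProduct, v] using hai
    · simpa [Matrix.mulVec, dotProduct, v, add_comm] using hbi
  · intro h z hz
    obtain ⟨v, hv, hvz⟩ := Matrix.exists_mulVec_eq_smul_of_mem_spectrum hz
    have h1 : M *ᵥ (fun i => (v i).re) = z.re • (fun i => (v i).re) - z.im • fun i => (v i).im := by
      funext i
      simpa [Matrix.mulVec, dotProduct] using congrArg Complex.re (congrFun hvz i)
    have h2 : M *ᵥ (fun i => (v i).im) = z.im • (fun i => (v i).re) + z.re • fun i => (v i).im := by
      funext i
      simpa [Matrix.mulVec, dotProduct, add_comm] using congrArg Complex.im (congrFun hvz i)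
    rcases h _ _ _ _ h1 h2 with h | ⟨h1, h2⟩
    · exact h
    · exact absurd (funext fun i => Complex.ext (congrFun h1 i) (congrFun h2 i)) hv

theorem SDRE.IsHurwitz.transpose {d : ℕ} {M : Matrix (Fin d) (Fin d) ℝ} (hM : SDRE.IsHurwitz M) :
    SDRE.IsHurwitz Mᵀ := by
  intro z hz
  refine hM z ?_
  rw [Matrix.transpose_map, Matrix.mem_spectrum_iff_isRoot_charpoly,
    Matrix.charpoly_transpose] at hz
  rwa [Matrix.mem_spectrum_iff_isRoot_charpoly]

/-- **Riccati stabilization**: if `(A, C)` is detectable, a positive semidefinite solution of the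
algebraic Riccati equation with weight `Q = Cᵀ C` gives a stabilizing feedback. -/
theorem SDRE.IsRiccatiSolution.isHurwitz {d m p : ℕ} {A : Matrix (Fin d) (Fin d) ℝ}
    {B : Matrix (Fin d) (Fin m) ℝ} {C : Matrix (Fin p) (Fin d) ℝ} {Q P : Matrix (Fin d) (Fin d) ℝ}
    {R : Matrix (Fin m) (Fin m) ℝ} (hR : R.PosDef) (hC : Cᵀ * C = Q) (hdet : SDRE.Detectable A C)
    (hP : SDRE.IsRiccatiSolution A B Q R P) :
    SDRE.IsHurwitz (A - B * R⁻¹ * Bᵀ * P) := by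
  obtain ⟨hPpos, hric⟩ := hP
  obtain ⟨K, hK⟩ := hdet
  replace hK := hK.transpose
  rw [Matrix.transpose_sub, Matrix.transpose_mul, Matrix.transpose_transpose,
    Matrix.transpose_transpose] at hK
  have hPsymm : Pᵀ = P := by
    simpa [Matrix.conjTranspose_eq_transpose_of_trivial] using hPpos.isHermitian.eq
  have hsym : ∀ x y : Fin d → ℝ, x ⬝ᵥ (P *ᵥ y) = y ⬝ᵥ (P *ᵥ x) := by
    intro x y
    rw [Matrix.dotProduct_mulVec, ← Matrix.mulVec_transpose, hPsymm, dotProduct_comm]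
  have hRinv : (R⁻¹).PosDef := hR.inv
  have hquad : ∀ x : Fin d → ℝ, 2 * (x ⬝ᵥ (P *ᵥ ((A - B * R⁻¹ * Bᵀ * P) *ᵥ x)))
      = -((C *ᵥ x) ⬝ᵥ (C *ᵥ x)) - (Bᵀ *ᵥ (P *ᵥ x)) ⬝ᵥ (R⁻¹ *ᵥ (Bᵀ *ᵥ (P *ᵥ x))) := by
    intro x
    have h1 := congrArg (fun X : Matrix (Fin d) (Fin d) ℝ => x ⬝ᵥ (X *ᵥ x)) hric
    simp only [← hC, Matrix.add_mulVec, Matrix.sub_mulVec, dotProduct_add, dotProduct_sub,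
      ← Matrix.mulVec_mulVec, Matrix.zero_mulVec, dotProduct_zero] at h1
    have h2 : x ⬝ᵥ (Aᵀ *ᵥ (P *ᵥ x)) = x ⬝ᵥ (P *ᵥ (A *ᵥ x)) := by
      rw [hsym x, Matrix.dotProduct_mulVec, Matrix.vecMul_transpose]
    have h3 : x ⬝ᵥ (Cᵀ *ᵥ (C *ᵥ x)) = (C *ᵥ x) ⬝ᵥ (C *ᵥ x) := by
      rw [Matrix.dotProduct_mulVec, Matrix.vecMul_transpose]
    have h4 : ∀ w, x ⬝ᵥ (P *ᵥ (B *ᵥ w)) = (Bᵀ *ᵥ (P *ᵥ x)) ⬝ᵥ w := by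
      intro w
      rw [hsym, dotProduct_comm, Matrix.dotProduct_mulVec, Matrix.mulVec_transpose]
    simp only [Matrix.sub_mulVec, Matrix.mulVec_sub, dotProduct_sub, ← Matrix.mulVec_mulVec]
    rw [h2, h3, h4] at h1
    rw [h4]
    linarith
  rw [SDRE.isHurwitz_iff_forall_real]
  intro α β a b ha hb
  by_contra! hcon
  obtain ⟨hα, hab⟩ := hcon
  have hPa : 0 ≤ a ⬝ᵥ (P *ᵥ a) := by simpa using hPpos.dotProduct_mulVec_nonneg a
  have hPb : 0 ≤ b ⬝ᵥ (P *ᵥ b) := by simpa using hPpos.dotProduct_mulVec_nonneg b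
  have hR0 : ∀ w : Fin m → ℝ, 0 ≤ w ⬝ᵥ (R⁻¹ *ᵥ w) := fun w => by
    simpa using hRinv.posSemidef.dotProduct_mulVec_nonneg w
  have hR1 : ∀ w : Fin m → ℝ, w ⬝ᵥ (R⁻¹ *ᵥ w) = 0 → w = 0 := fun w hw => by
    by_contra hne
    have := hRinv.dotProduct_mulVec_pos hne
    simp [hw] at this
  have hC0 : ∀ w : Fin p → ℝ, 0 ≤ w ⬝ᵥ w := fun w =>
    Finset.sum_nonneg fun i _ => mul_self_nonneg _
  have qa := hquad a
  have qb := hquad b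
  rw [ha] at qa
  rw [hb] at qb
  simp only [Matrix.mulVec_sub, Matrix.mulVec_add, Matrix.mulVec_smul, dotProduct_sub,
    dotProduct_add, dotProduct_smul, smul_eq_mul] at qa qb
  -- Adding the identities for `a` and `b` cancels the `β` terms. The left side is then nonnegative
  -- and the right side a sum of nonpositive terms, so each term vanishes.
  have hsum : 0 ≤ α * (a ⬝ᵥ (P *ᵥ a)) + α * (b ⬝ᵥ (P *ᵥ b)) := by positivity
  rw [hsym b a] at qb
  have e1 := hC0 (C *ᵥ a)
  have e2 := hC0 (C *ᵥ b)
  have e3 := hR0 (Bᵀ *ᵥ (P *ᵥ a))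
  have e4 := hR0 (Bᵀ *ᵥ (P *ᵥ b))
  have za : C *ᵥ a = 0 := dotProduct_self_eq_zero.1 (by linarith)
  have zb : C *ᵥ b = 0 := dotProduct_self_eq_zero.1 (by linarith)
  have wa : Bᵀ *ᵥ (P *ᵥ a) = 0 := hR1 _ (by linarith)
  have wb : Bᵀ *ᵥ (P *ᵥ b) = 0 := hR1 _ (by linarith)
  have ka : (A - Kᵀ * C) *ᵥ a = α • a - β • b := by
    rw [← ha]
    simp [Matrix.sub_mulVec, ← Matrix.mulVec_mulVec, za, wa]
  have kb : (A - Kᵀ * C) *ᵥ b = β • a + α • b := by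
    rw [← hb]
    simp [Matrix.sub_mulVec, ← Matrix.mulVec_mulVec, zb, wb]
  rcases SDRE.isHurwitz_iff_forall_real.1 hK α β a b ka kb with h | h
  · linarith
  · exact hab h.1 h.2

/-! ### Gradient of a state-dependent quadratic form -/

section Gradient

open scoped RealInnerProductSpace
open Asymptotics

variable {E : Type*} [NormedAddCommGroup E] [InnerProductSpace ℝ E]

/-- Applied to the deviation of the coefficient matrix from its value at the origin, this lets mere
continuity of the coefficients suffice for linearization. -/
theorem isLittleO_clm_apply_self {H : E → E →L[ℝ] E} (hH : Filter.Tendsto H (𝓝 0) (𝓝 0)) :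
    (fun x => H x x) =o[𝓝 0] (fun x : E => x) := by
  have h1 : (fun x => H x x) =O[𝓝 0] (fun x : E => ‖H x‖ * ‖x‖) :=
    IsBigO.of_bound 1 (Filter.Eventually.of_forall fun x => by
      rw [one_mul, norm_mul, norm_norm, norm_norm]; exact (H x).le_opNorm x)
  have h2 : (fun x : E => ‖H x‖ * ‖x‖) =o[𝓝 0] (fun x : E => 1 * ‖x‖) := by
    refine IsLittleO.mul_isBigO ?_ (isBigO_refl _ _)
    rw [isLittleO_one_iff]
    simpa using hH.norm
  simp only [one_mul] at h2
  exact (h1.trans_isLittleO h2).of_norm_right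

variable [CompleteSpace E] {Γ : E → E →L[ℝ] E}

/-- The gradient of the state-dependent quadratic form `⟪x, Γ(x) x⟫` is `2 Γ(x) x` up to terms of
higher order at the origin. -/
theorem isLittleO_gradient_inner_apply_self (hΓ : ContDiffAt ℝ 1 Γ 0)
    (hsymm : ∀ᶠ x in 𝓝 0, ∀ u v, ⟪Γ x u, v⟫ = ⟪u, Γ x v⟫) :
    (fun x => gradient (fun x => ⟪x, Γ x x⟫) x - (2 : ℝ) • Γ x x) =o[𝓝 0] (fun x : E => x) := by
  have hev : ∀ᶠ x in 𝓝 (0 : E), DifferentiableAt ℝ Γ x :=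
    (hΓ.eventually (by simp)).mono fun x hx => hx.differentiableAt (by simp)
  have hc : ContinuousAt (fderiv ℝ Γ) 0 := (hΓ.fderiv_right (m := 0) (by simp)).continuousAt
  have hcn : ContinuousAt (fun x => ‖fderiv ℝ Γ x‖) 0 :=
    (continuous_norm (E := E →L[ℝ] E →L[ℝ] E)).continuousAt.comp hc
  have hbd : ∀ᶠ x in 𝓝 (0 : E), ‖fderiv ℝ Γ x‖ ≤ ‖fderiv ℝ Γ 0‖ + 1 :=
    (hcn.eventually_lt_const (lt_add_one _)).mono fun x hx => hx.le
  have hO : (fun x => gradient (fun x => ⟪x, Γ x x⟫) x - (2 : ℝ) • Γ x x)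
      =O[𝓝 0] (fun x : E => ‖x‖ * ‖x‖) := by
    refine IsBigO.of_bound (‖fderiv ℝ Γ 0‖ + 1) ?_
    filter_upwards [hev, hbd, hsymm] with x hx hxb hxs
    have h1 := (hasFDerivAt_id x).inner ℝ (hx.hasFDerivAt.clm_apply (hasFDerivAt_id x))
    have h2 : HasFDerivAt (fun x => ⟪x, Γ x x⟫) _ x := h1
    rw [gradient, h2.fderiv, ← (InnerProductSpace.toDual ℝ E).norm_map, map_sub,
      LinearIsometryEquiv.apply_symm_apply]
    refine ContinuousLinearMap.opNorm_le_bound _ (by positivity) fun h => ?_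
    have h3 : ‖⟪x, fderiv ℝ Γ x h x⟫‖ ≤ (‖fderiv ℝ Γ 0‖ + 1) * ‖‖x‖ * ‖x‖‖ * ‖h‖ := by
      calc ‖⟪x, fderiv ℝ Γ x h x⟫‖ ≤ ‖x‖ * ‖fderiv ℝ Γ x h x‖ := norm_inner_le_norm _ _
        _ ≤ ‖x‖ * (((‖fderiv ℝ Γ 0‖ + 1) * ‖h‖) * ‖x‖) := by
          gcongr
          exact (fderiv ℝ Γ x h).le_of_opNorm_le ((fderiv ℝ Γ x).le_of_opNorm_le hxb h) x
        _ = _ := by rw [norm_mul, norm_norm]; ring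
    -- By symmetry of `Γ x`, what remains after subtracting `2 Γ(x) x` is exactly the term in which
    -- `Γ` itself is differentiated, quadratic in `x`.
    refine le_trans (le_of_eq ?_) h3
    congr 1
    have h4 := hxs h x
    have h5 := real_inner_comm h (Γ x x)
    have h6 := hxs x h
    simp [fderivInnerCLM_apply, inner_add_right]
    linarith
  refine hO.trans_isLittleO ?_
  have : (fun x : E => ‖x‖ * ‖x‖) =o[𝓝 0] (fun x : E => 1 * ‖x‖) := by
    refine IsLittleO.mul_isBigO ?_ (isBigO_refl _ _)
    rw [isLittleO_one_iff]
    exact continuous_norm.tendsto' _ _ norm_zero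
  simp only [one_mul] at this
  exact this.of_norm_right

/-- Continuity is needed at all nearby points, since Peano's theorem is used on a whole ball. -/
theorem eventually_continuousAt_gradient {V : E → ℝ} {x₀ : E} (hV : ContDiffAt ℝ 1 V x₀) :
    ∀ᶠ x in 𝓝 x₀, ContinuousAt (gradient V) x := by
  filter_upwards [hV.eventually (by simp)] with x hx
  exact (InnerProductSpace.toDual ℝ E).symm.continuous.continuousAt.comp
    (hx.fderiv_right (m := 0) (by simp)).continuousAt

end Gradient

/-! ### Linearization of the closed loop -/

/-- **Lyapunov's indirect method** for a continuous vector field with stable linearization at the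
origin. -/
theorem SDRE.LocallyAsymptoticallyStable.of_linearization {d : ℕ}
    {F : EuclideanSpace ℝ (Fin d) → EuclideanSpace ℝ (Fin d)} {M : Matrix (Fin d) (Fin d) ℝ}
    (hM : SDRE.IsHurwitz M) (hF0 : F 0 = 0) (hF : ∀ᶠ x in 𝓝 0, ContinuousAt F x)
    (hFM : (fun x => F x - Matrix.toEuclideanCLM (𝕜 := ℝ) M x) =o[𝓝 0] (fun x => x)) :
    SDRE.LocallyAsymptoticallyStable F := by
  obtain ⟨W, W', C, L, c, hC, hL, hc, hW, hW1, hW2, hW3, hWM⟩ := hM.exists_lyapunov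
  -- With `‖W' x‖ ≤ L * ‖x‖`, the slope `c / 2 / L` lets the remainder consume at most half of the
  -- decay rate `c`.
  have hev := hF.and (hFM.bound (c := c / 2 / L) (by positivity))
  obtain ⟨ρ, hρ, hball⟩ := Metric.nhds_basis_closedBall.eventually_iff.1 hev
  refine SDRE.LocallyAsymptoticallyStable.of_lyapunov (c := c / 2) hC (by positivity) hρ hF0
    (fun x hx => (hball hx).1.continuousWithinAt) hW hW1 hW2 fun x hx => ?_
  have h1 := (hball (mem_closedBall_zero_iff.2 hx)).2
  set μ := Matrix.toEuclideanCLM (𝕜 := ℝ) M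
  have h2 : W' x (F x - μ x) ≤ c / 2 * ‖x‖ ^ 2 := by
    calc W' x (F x - μ x) ≤ ‖W' x (F x - μ x)‖ := Real.le_norm_self _
      _ ≤ (L * ‖x‖) * (c / 2 / L * ‖x‖) :=
        ((W' x).le_of_opNorm_le (hW3 x) _).trans (by gcongr)
      _ = c / 2 * ‖x‖ ^ 2 := by field_simp
  rw [map_sub] at h2
  linarith [hWM x]

theorem Matrix.continuous_toEuclideanCLM {d : ℕ} :
    Continuous (Matrix.toEuclideanCLM (n := Fin d) (𝕜 := ℝ)) :=
  (Matrix.toEuclideanCLM (n := Fin d) (𝕜 := ℝ)).toAlgEquiv.toLinearMap.continuous_of_finiteDimensional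

theorem Matrix.contDiffAt_toEuclideanCLM {d : ℕ} {E : Type*} [NormedAddCommGroup E]
    [NormedSpace ℝ E] {n : WithTop ℕ∞} {P : E → Matrix (Fin d) (Fin d) ℝ} {x₀ : E}
    (hP : ∀ i j, ContDiffAt ℝ n (fun x => P x i j) x₀) :
    ContDiffAt ℝ n (fun x => Matrix.toEuclideanCLM (𝕜 := ℝ) (P x)) x₀ := by
  have h1 : (fun x => Matrix.toEuclideanCLM (𝕜 := ℝ) (P x)) = fun x =>
      ∑ i, ∑ j, P x i j • Matrix.toEuclideanCLM (𝕜 := ℝ) (Matrix.single i j (1 : ℝ)) := by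
    funext x
    conv_lhs => rw [Matrix.matrix_eq_sum_single (P x)]
    simp only [map_sum, ← map_smul, Matrix.smul_single, smul_eq_mul, mul_one]
  rw [h1]
  exact ContDiffAt.sum fun i _ => ContDiffAt.sum fun j _ => (hP i j).smul contDiffAt_const

/-- The closed loop with the corrected feedback, in terms of continuous linear maps. -/
theorem SDRE.closedLoop_correctedFeedback_eq {d m : ℕ}
    {f : EuclideanSpace ℝ (Fin d) → EuclideanSpace ℝ (Fin d)}
    {A : EuclideanSpace ℝ (Fin d) → Matrix (Fin d) (Fin d) ℝ}
    (B : EuclideanSpace ℝ (Fin d) → Matrix (Fin d) (Fin m) ℝ) (R : Matrix (Fin m) (Fin m) ℝ)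
    (P : EuclideanSpace ℝ (Fin d) → Matrix (Fin d) (Fin d) ℝ) {x : EuclideanSpace ℝ (Fin d)}
    (hx : f x = WithLp.toLp 2 (A x *ᵥ x.ofLp)) :
    SDRE.closedLoop f B (SDRE.correctedFeedback B R P) x =
      Matrix.toEuclideanCLM (𝕜 := ℝ) (A x) x - (1 / 2 : ℝ) •
        Matrix.toEuclideanCLM (𝕜 := ℝ) (B x * R⁻¹ * (B x)ᵀ) (gradient (SDRE.valueS P) x) := by
  apply (WithLp.ofLp_injective 2)
  simp [SDRE.closedLoop, SDRE.correctedFeedback, hx, Matrix.mulVec_neg, Matrix.mulVec_smul,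
    Matrix.mulVec_mulVec, sub_eq_add_neg, Matrix.mul_assoc]

theorem mainTheorem1 (d m : ℕ)
    (f : EuclideanSpace ℝ (Fin d) → EuclideanSpace ℝ (Fin d))
    (A : EuclideanSpace ℝ (Fin d) → Matrix (Fin d) (Fin d) ℝ)
    (B : EuclideanSpace ℝ (Fin d) → Matrix (Fin d) (Fin m) ℝ)
    (Q : Matrix (Fin d) (Fin d) ℝ) (hQ : Q.PosSemidef)
    (R : Matrix (Fin m) (Fin m) ℝ) (hR : R.PosDef)
    (r : ℝ) (hr : 0 < r)
    (hf : ContDiffOn ℝ 1 f (Metric.closedBall 0 r))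
    (O : Set (EuclideanSpace ℝ (Fin d))) (hO : O ∈ 𝓝 0) (hOr : O ⊆ Metric.ball 0 r)
    (hfA : ∀ x ∈ O, f x = WithLp.toLp 2 (A x *ᵥ x.ofLp))
    (hA : ContinuousOn A O) (hB : ContinuousOn B O)
    (hstab : ∀ x ∈ O, SDRE.Stabilizable (A x) (B x))
    (hdet : ∀ x ∈ O, SDRE.Detectable (A x) (CFC.sqrt Q))
    (P : EuclideanSpace ℝ (Fin d) → Matrix (Fin d) (Fin d) ℝ)
    (hP : ∀ x ∈ O, SDRE.IsRiccatiSolution (A x) (B x) Q R (P x))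
    (hPdiff : ∀ i j, ContDiffAt ℝ 1 (fun x => P x i j) 0) :
    SDRE.LocallyAsymptoticallyStable
      (SDRE.closedLoop f B (SDRE.correctedFeedback B R P)) := by
  have h0 : (0 : EuclideanSpace ℝ (Fin d)) ∈ O := mem_of_mem_nhds hO
  have hsqrt : (CFC.sqrt Q)ᵀ * CFC.sqrt Q = Q := by
    have h1 : (CFC.sqrt Q).PosSemidef := Matrix.nonneg_iff_posSemidef.1 (CFC.sqrt_nonneg Q)
    rw [← Matrix.conjTranspose_eq_transpose_of_trivial, h1.isHermitian.eq]
    exact CFC.sqrt_mul_sqrt_self Q (Matrix.nonneg_iff_posSemidef.2 hQ)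
  let Φ := Matrix.toEuclideanCLM (n := Fin d) (𝕜 := ℝ)
  have hΦ : Continuous Φ := Matrix.continuous_toEuclideanCLM
  let Γ := fun x => Φ (P x)
  let G := fun x => B x * R⁻¹ * (B x)ᵀ
  let g := gradient (SDRE.valueS P)
  have hV : SDRE.valueS P = fun x => inner ℝ x (Γ x x) := by
    funext x
    exact (Matrix.inner_toEuclideanCLM (P x) x x).symm
  have hΓ : ContDiffAt ℝ 1 Γ 0 := Matrix.contDiffAt_toEuclideanCLM hPdiff
  have hVd : ContDiffAt ℝ 1 (SDRE.valueS P) 0 := by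
    rw [hV]; exact contDiffAt_id.inner ℝ (hΓ.clm_apply contDiffAt_id)
  have hsymm : ∀ᶠ x in 𝓝 0, ∀ u v, inner ℝ (Γ x u) v = inner ℝ u (Γ x v) := by
    filter_upwards [hO] with x hx u v
    have h1 : star (P x) = P x := (hP x hx).1.isHermitian.eq
    have h2 : ContinuousLinearMap.adjoint (Γ x) = Γ x := by
      rw [← ContinuousLinearMap.star_eq_adjoint]
      simp only [Γ, ← map_star, h1]
    rw [← ContinuousLinearMap.adjoint_inner_right, h2]
  have hg : (fun x => g x - (2 : ℝ) • Γ x x) =o[𝓝 0] (fun x => x) := by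
    simp only [g, hV]
    exact isLittleO_gradient_inner_apply_self hΓ hsymm
  have hg0 : g 0 = 0 := by
    simpa using (hg.bound one_pos).self_of_nhds
  have hAc : ∀ᶠ x in 𝓝 0, ContinuousAt A x := by
    filter_upwards [eventually_mem_nhds_iff.2 hO] with x hx using hA.continuousAt hx
  have hGc : ∀ᶠ x in 𝓝 0, ContinuousAt G x := by
    filter_upwards [eventually_mem_nhds_iff.2 hO] with x hx
    have hc : Continuous fun X : Matrix (Fin d) (Fin m) ℝ => X * R⁻¹ * Xᵀ :=
      (continuous_id.matrix_mul continuous_const).matrix_mul continuous_id.matrix_transpose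
    exact hc.continuousAt.comp (hB.continuousAt hx)
  have hPc : ContinuousAt P 0 :=
    continuousAt_pi.2 fun i => continuousAt_pi.2 fun j => (hPdiff i j).continuousAt
  have hF : ∀ x ∈ O, SDRE.closedLoop f B (SDRE.correctedFeedback B R P) x =
      Φ (A x) x - (1 / 2 : ℝ) • Φ (G x) (g x) := fun x hx =>
    SDRE.closedLoop_correctedFeedback_eq B R P (hfA x hx)
  refine SDRE.LocallyAsymptoticallyStable.of_linearization
    ((hP 0 h0).isHurwitz hR hsqrt (hdet 0 h0)) ?_ ?_ ?_
  · rw [hF 0 h0, hg0]; simp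
  · filter_upwards [eventually_mem_nhds_iff.2 hO, hAc, hGc, eventually_continuousAt_gradient hVd]
      with x hx hAx hGx hgx
    have hAx' : ContinuousAt (fun x => Φ (A x)) x := hΦ.continuousAt.comp hAx
    have hGx' : ContinuousAt (fun x => Φ (G x)) x := hΦ.continuousAt.comp hGx
    have h1 : ContinuousAt (fun x => Φ (A x) x - (1 / 2 : ℝ) • Φ (G x) (g x)) x :=
      (hAx'.clm_apply continuousAt_id).sub ((hGx'.clm_apply hgx).const_smul (1 / 2 : ℝ))
    refine h1.congr ?_
    filter_upwards [hx] with y hy using (hF y hy).symm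
  · have hA0 := hAc.self_of_nhds
    have hG0 := hGc.self_of_nhds
    -- The closed loop is `H x x` minus half of `Φ (G x)` applied to the gradient error, and `H 0`
    -- is the stable Riccati matrix.
    let H := fun x => Φ (A x - G x * P x)
    have hHc : ContinuousAt H 0 := hΦ.continuousAt.comp (hA0.sub (hG0.mul hPc))
    have hH : Filter.Tendsto (fun x => H x - H 0) (𝓝 0) (𝓝 0) := by
      simpa using hHc.tendsto.sub_const (H 0)
    have hGg : (fun x => Φ (G x) (g x - (2 : ℝ) • Γ x x)) =o[𝓝 0] (fun x => x) := by
      have hΦG : Filter.Tendsto (fun x => Φ (G x)) (𝓝 0) (𝓝 (Φ (G 0))) :=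
        (hΦ.continuousAt.comp hG0).tendsto
      have h1 : (fun x => Φ (G x) (g x - (2 : ℝ) • Γ x x))
          =O[𝓝 0] fun x => ‖Φ (G x)‖ * ‖g x - (2 : ℝ) • Γ x x‖ :=
        Asymptotics.IsBigO.of_bound 1 (Filter.Eventually.of_forall fun x => by
          rw [one_mul, norm_mul, norm_norm, norm_norm]; exact (Φ (G x)).le_opNorm _)
      have h2 := (hΦG.norm.isBigO_one ℝ).mul_isLittleO hg.norm_norm
      simp only [one_mul] at h2
      exact (h1.trans_isLittleO h2).of_norm_right
    refine ((isLittleO_clm_apply_self hH).sub (hGg.const_smul_left (1 / 2 : ℝ))).congr' ?_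
      Filter.EventuallyEq.rfl
    filter_upwards [hO] with x hx
    rw [hF x hx]
    change _ = _ - H 0 x
    simp only [H, Γ, map_sub, map_mul, map_smul, sub_apply,
      mul_apply_eq_comp, Pi.smul_apply]
    module
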